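/- Let $X$ be a uniformly convex complex Banach space with open unit ball $B_X$, and let $Y$ be an arbitrary complex Banach space. Let $\mathcal{A}_u(B_X;Y)$ be the space of all holomorphic functions $f:B_X\to Y$ that are uniformly continuous on $B_X$, with the supremum norm $\|f\|_\infty=\sup_{x\in B_X}\|f(x)\|$. Define the weighted norm of $f\in\mathcal{A}_u(B_X;Y)$ by $$\|f\|_v=\sup_{x\in B_X}(1-\|x\|^2)\,\|f(x)\|,$$ and say that $f$ attains its weighted norm if there is $x_0\in\overline{B_X}$ with $\|f\|_v=(1-\|x_0\|^2)\|f(x_0)\|$ (where $f$ is extended continuously to $\overline{B_X}$). Let $\mathrm{NA}_v\mathcal{A}_u(B_X;Y)$ be the set of all $f\in\mathcal{A}_u(B_X;Y)$ that attain their weighted norm. Then $$\overline{\mathrm{NA}_v\mathcal{A}_u(B_X;Y)}^{\|\cdot\|_\infty}=\mathcal{A}_u(B_X;Y),$$ that is, for every $f\in\mathcal{A}_u(B_X;Y)$ and every $\varepsilon>0$ there is $g\in\mathcal{A}_u(B_X;Y)$ attaining its weighted norm with $\|f-g\|_\infty<\varepsilon$. -/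

import Mathlib

open scoped BoundedContinuousFunction

noncomputable section

/-- The open unit ball `B_X` of `X`, as a type. -/
abbrev OpenUnitBall (X : Type*) [NormedAddCommGroup X] : Type _ :=
  ↥(Metric.ball (0 : X) 1)

/-- A function on `B_X` viewed as a function on `X`, with value `0` outside `B_X`. Only its values
on `B_X` matter in what follows. -/
def extendByZero {X Y : Type*} [NormedAddCommGroup X] [NormedAddCommGroup Y]
    (f : OpenUnitBall X → Y) : X → Y :=
  Function.extend Subtype.val f 0

theorem extendByZero_coe {X Y : Type*} [NormedAddCommGroup X] [NormedAddCommGroup Y]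
    (f : OpenUnitBall X → Y) (x : OpenUnitBall X) : extendByZero f (x : X) = f x :=
  Subtype.val_injective.extend_apply f 0 x

/-- A function on `B_X` is holomorphic if it is complex (Fréchet) differentiable at every point
of the open set `B_X`. -/
def IsHolomorphicOnBall {X Y : Type*} [NormedAddCommGroup X] [NormedSpace ℂ X]
    [NormedAddCommGroup Y] [NormedSpace ℂ Y] (f : OpenUnitBall X → Y) : Prop :=
  DifferentiableOn ℂ (extendByZero f) (Metric.ball (0 : X) 1)

/-- The space `𝒜_u(B_X; Y)` of all uniformly continuous holomorphic functions `B_X → Y`.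
A uniformly continuous function on the ball is automatically bounded, so the space is a subspace
of the space of bounded continuous functions on `B_X`, whose norm is the supremum norm. -/
def Au (X Y : Type*) [NormedAddCommGroup X] [NormedSpace ℂ X]
    [NormedAddCommGroup Y] [NormedSpace ℂ Y] : Submodule ℂ (OpenUnitBall X →ᵇ Y) where
  carrier := {f | IsHolomorphicOnBall (f : OpenUnitBall X → Y) ∧
    UniformContinuous (f : OpenUnitBall X → Y)}
  zero_mem' := by
    refine ⟨?_, uniformContinuous_const⟩
    refine (differentiableOn_const (0 : Y)).congr fun x hx => ?_
    exact extendByZero_coe _ ⟨x, hx⟩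
  add_mem' := by
    rintro f g ⟨hf, hf'⟩ ⟨hg, hg'⟩
    refine ⟨(hf.add hg).congr fun x hx => ?_, hf'.add hg'⟩
    have h1 := extendByZero_coe (⇑(f + g)) ⟨x, hx⟩
    have h2 := extendByZero_coe (⇑f) ⟨x, hx⟩
    have h3 := extendByZero_coe (⇑g) ⟨x, hx⟩
    exact h1.trans (congrArg₂ (· + ·) h2.symm h3.symm)
  smul_mem' := by
    rintro c f ⟨hf, hf'⟩
    refine ⟨(hf.const_smul c).congr fun x hx => ?_, hf'.const_smul c⟩
    have h1 := extendByZero_coe (⇑(c • f)) ⟨x, hx⟩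
    have h2 := extendByZero_coe (⇑f) ⟨x, hx⟩
    exact h1.trans (congrArg (c • ·) h2.symm)

/-- The weighted norm `‖f‖_v = sup_{x ∈ B_X} (1 - ‖x‖²) ‖f(x)‖` for the standard weight. -/
def weightedNorm {X Y : Type*} [NormedAddCommGroup X] [NormedAddCommGroup Y]
    (f : OpenUnitBall X → Y) : ℝ :=
  ⨆ x : OpenUnitBall X, (1 - ‖(x : X)‖ ^ 2) * ‖f x‖

/-- `f` attains its weighted norm: there is `x₀` in the closed unit ball with
`‖f‖_v = (1 - ‖x₀‖²) ‖f(x₀)‖`. For `‖x₀‖ = 1` the right-hand side is `0`, whatever value `f` is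
given at `x₀`. -/
def AttainsWeightedNorm {X Y : Type*} [NormedAddCommGroup X] [NormedAddCommGroup Y]
    (f : OpenUnitBall X → Y) : Prop :=
  ∃ x₀ ∈ Metric.closedBall (0 : X) 1,
    weightedNorm f = (1 - ‖x₀‖ ^ 2) * ‖extendByZero f x₀‖

/-- The set `NA_v 𝒜_u(B_X; Y)` of the elements of `𝒜_u(B_X; Y)` that attain their weighted norm. -/
def NAvAu (X Y : Type*) [NormedAddCommGroup X] [NormedSpace ℂ X]
    [NormedAddCommGroup Y] [NormedSpace ℂ Y] : Set (Au X Y) :=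
  {f | AttainsWeightedNorm (f.1 : OpenUnitBall X → Y)}

end

open scoped BoundedContinuousFunction Topology
open Filter Metric

/-! Baire category in the complete space `Au X Y`. If the near-maximal weighted values of `f` are
taken in balls of arbitrarily small radius, maximizing sequences are Cauchy and `f` attains its
weighted norm. For each radius this peaking condition is open; density is the point.

Given `f ≠ 0`, take a near-maximizer `x₀`, put `r = ‖x₀‖`, choose `φ` norming `x₀`, and add a small
multiple of `h(x) = (1 - r φ(x))⁻² y` with `y = f(x₀)/‖f(x₀)‖`. By Schwarz–Pick the weighted value
of `h` is at most `(1 - r²)⁻¹`, attained at `x₀`; near equality forces `φ(x) ≈ r` and `‖x‖ ≈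
|φ(x)|`, so uniform convexity gives `x ≈ x₀`. The perturbed function inherits this peak, since `f`
and `h` align at `x₀`. The peak estimate must be uniform in `‖x₀‖ ≤ R < 1`, because `x₀` is chosen
after its constants. -/

/-- A uniform limit of holomorphic functions on an open subset of a complex normed space is
holomorphic. -/
theorem differentiableOn_of_tendstoUniformlyOn {E F : Type*} [NormedAddCommGroup E]
    [NormedSpace ℂ E] [NormedAddCommGroup F] [NormedSpace ℂ F] [CompleteSpace F]
    {f : ℕ → E → F} {g : E → F} {U : Set E} (hU : IsOpen U)
    (hf : ∀ n, DifferentiableOn ℂ (f n) U) (h : TendstoUniformlyOn f g atTop U) :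
    DifferentiableOn ℂ g U := by
  intro x hx
  obtain ⟨r, hr, hrU⟩ := Metric.isOpen_iff.1 hU x hx
  have hr2 : 0 < r / 2 := half_pos hr
  have hsub : ∀ y ∈ ball x (r / 2), ball y (r / 2) ⊆ U := fun y hy z hz => hrU <| by
    have h1 := dist_triangle z y x
    rw [mem_ball] at hy hz ⊢
    linarith
  have hc : UniformCauchySeqOn (fun n => fderiv ℂ (f n)) atTop (ball x (r / 2)) := by
    rw [Metric.uniformCauchySeqOn_iff]
    intro ε hε
    -- Cauchy's estimate on a ball of radius `r / 2` turns an oscillation `ε * r / 4` into a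
    -- derivative bound `ε / 2`.
    obtain ⟨N, hN⟩ := Metric.uniformCauchySeqOn_iff.1 h.uniformCauchySeqOn (ε * r / 8)
      (by positivity)
    refine ⟨N, fun m hm n hn y hy => ?_⟩
    have hyU : y ∈ U := hsub y hy (mem_ball_self hr2)
    have hd : DifferentiableOn ℂ (f m - f n) (ball y (r / 2)) :=
      ((hf m).sub (hf n)).mono (hsub y hy)
    have hmaps : Set.MapsTo (f m - f n) (ball y (r / 2))
        (closedBall ((f m - f n) y) (ε * r / 4)) := by
      intro z hz
      have h1 := hN m hm n hn z (hsub y hy hz)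
      have h2 := hN m hm n hn y hyU
      rw [dist_eq_norm] at h1 h2
      rw [mem_closedBall, dist_eq_norm]
      refine (norm_sub_le _ _).trans ?_
      simp only [Pi.sub_apply]
      linarith
    have key := Complex.norm_fderiv_le_div_of_mapsTo_ball hd hmaps hr2
    rw [fderiv_sub ((hf m).differentiableAt (hU.mem_nhds hyU))
      ((hf n).differentiableAt (hU.mem_nhds hyU))] at key
    rw [dist_eq_norm]
    refine key.trans_lt ?_
    rw [div_lt_iff₀ hr2]
    nlinarith [mul_pos hε hr]
  have hlim : ∀ y ∈ ball x (r / 2), ∃ L, Tendsto (fun n => fderiv ℂ (f n) y) atTop (𝓝 L) :=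
    fun y hy => cauchySeq_tendsto_of_complete (hc.cauchySeq hy)
  choose! g' hg' using hlim
  have hyU : ∀ y ∈ ball x (r / 2), y ∈ U := fun y hy => hsub y hy (mem_ball_self hr2)
  exact (hasFDerivAt_of_tendstoUniformlyOn isOpen_ball
    (hc.tendstoUniformlyOn_of_tendsto hg')
    (fun n y hy => ((hf n).differentiableAt (hU.mem_nhds (hyU y hy))).hasFDerivAt)
    (fun y hy => h.tendsto_at (hyU y hy)) (mem_ball_self hr2)).differentiableAt
    |>.differentiableWithinAt

theorem isClosed_Au (X Y : Type*) [NormedAddCommGroup X] [NormedSpace ℂ X]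
    [NormedAddCommGroup Y] [NormedSpace ℂ Y] [CompleteSpace Y] :
    IsClosed (Au X Y : Set (OpenUnitBall X →ᵇ Y)) := by
  refine isClosed_of_closure_subset fun f hf => ?_
  obtain ⟨u, hu, hlim⟩ := mem_closure_iff_seq_limit.1 hf
  have hunif := BoundedContinuousFunction.tendsto_iff_tendstoUniformly.1 hlim
  refine ⟨differentiableOn_of_tendstoUniformlyOn (f := fun n => extendByZero (u n)) isOpen_ball
    (fun n => (hu n).1) ?_, hunif.uniformContinuous (Frequently.of_forall fun n => (hu n).2)⟩
  rw [Metric.tendstoUniformlyOn_iff]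
  intro ε hε
  filter_upwards [Metric.tendstoUniformly_iff.1 hunif ε hε] with n hn x hx
  have h1 := extendByZero_coe f ⟨x, hx⟩
  have h2 := extendByZero_coe (u n) ⟨x, hx⟩
  have h3 := hn ⟨x, hx⟩
  simp only at h1 h2
  rwa [h1, h2]

/-! ### Peaking functions and attainment -/

section Weighted

variable {X Y : Type*} [NormedAddCommGroup X] [NormedAddCommGroup Y]

theorem weight_nonneg (x : OpenUnitBall X) : 0 ≤ 1 - ‖(x : X)‖ ^ 2 := by
  have := mem_ball_zero_iff.1 x.2
  nlinarith [norm_nonneg (x : X)]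

theorem weight_pos (x : OpenUnitBall X) : 0 < 1 - ‖(x : X)‖ ^ 2 := by
  have := mem_ball_zero_iff.1 x.2
  nlinarith [norm_nonneg (x : X)]

theorem weight_le_one (x : OpenUnitBall X) : 1 - ‖(x : X)‖ ^ 2 ≤ 1 := by
  nlinarith [sq_nonneg ‖(x : X)‖]

theorem weighted_le_norm (f : OpenUnitBall X →ᵇ Y) (x : OpenUnitBall X) :
    (1 - ‖(x : X)‖ ^ 2) * ‖f x‖ ≤ ‖f‖ :=
  (mul_le_of_le_one_left (norm_nonneg _) (weight_le_one x)).trans (f.norm_coe_le_norm x)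

theorem bddAbove_weighted (f : OpenUnitBall X →ᵇ Y) :
    BddAbove (Set.range fun x : OpenUnitBall X => (1 - ‖(x : X)‖ ^ 2) * ‖f x‖) :=
  ⟨‖f‖, by rintro _ ⟨x, rfl⟩; exact weighted_le_norm f x⟩

theorem weighted_le_weightedNorm (f : OpenUnitBall X →ᵇ Y) (x : OpenUnitBall X) :
    (1 - ‖(x : X)‖ ^ 2) * ‖f x‖ ≤ weightedNorm f :=
  le_ciSup (bddAbove_weighted f) x

theorem weighted_le_add (f g : OpenUnitBall X →ᵇ Y) (x : OpenUnitBall X) :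
    (1 - ‖(x : X)‖ ^ 2) * ‖f x‖ ≤ (1 - ‖(x : X)‖ ^ 2) * ‖g x‖ + dist f g := by
  have h1 : ‖f x‖ ≤ ‖g x‖ + dist f g := by
    have := (dist_eq_norm (f x) (g x)).symm.le.trans (BoundedContinuousFunction.dist_coe_le_dist x)
    linarith [norm_sub_norm_le (f x) (g x)]
  have h2 := mul_le_mul_of_nonneg_left h1 (weight_nonneg x)
  have h3 := mul_le_of_le_one_left (dist_nonneg (x := f) (y := g)) (weight_le_one x)
  linarith

instance : Nonempty (OpenUnitBall X) := ⟨⟨0, mem_ball_self one_pos⟩⟩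

theorem exists_lt_weighted (f : OpenUnitBall X → Y) {c : ℝ} (hc : c < weightedNorm f) :
    ∃ x : OpenUnitBall X, c < (1 - ‖(x : X)‖ ^ 2) * ‖f x‖ :=
  exists_lt_of_lt_ciSup hc

/-- The weighted values of `f` that are close to the weighted norm are all taken within a ball of
radius `ε`. -/
def PeaksWithin (ε : ℝ) (f : OpenUnitBall X → Y) : Prop :=
  ∃ z : X, ∃ c < weightedNorm f, ∀ x : OpenUnitBall X,
    c < (1 - ‖(x : X)‖ ^ 2) * ‖f x‖ → ‖(x : X) - z‖ < ε

theorem isOpen_peaksWithin (ε : ℝ) :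
    IsOpen {f : OpenUnitBall X →ᵇ Y | PeaksWithin ε (f : OpenUnitBall X → Y)} := by
  rw [Metric.isOpen_iff]
  rintro f ⟨z, c, hc, h⟩
  obtain ⟨x₀, hx₀⟩ := exists_lt_weighted f hc
  -- Half the gap: passing to `g` raises the threshold by `dist g f` and lowers the value at `x₀` by
  -- at most as much.
  refine ⟨((1 - ‖(x₀ : X)‖ ^ 2) * ‖f x₀‖ - c) / 2, by linarith, fun g hg => ?_⟩
  rw [mem_ball] at hg
  refine ⟨z, c + dist g f, ?_, fun x hx => h x ?_⟩
  · have h1 := weighted_le_add f g x₀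
    rw [dist_comm] at h1
    linarith [weighted_le_weightedNorm g x₀]
  · linarith [weighted_le_add g f x]

/-- A function whose weighted values peak within balls of arbitrarily small radius attains its
weighted norm: maximizing sequences converge. -/
theorem attainsWeightedNorm_of_peaksWithin [CompleteSpace X] (f : OpenUnitBall X →ᵇ Y)
    (hf : ∀ n : ℕ, PeaksWithin (1 / ((n : ℝ) + 1)) (f : OpenUnitBall X → Y)) :
    AttainsWeightedNorm (f : OpenUnitBall X → Y) := by
  obtain ⟨v, -, hv, hvm⟩ := exists_seq_tendsto_sSup (Set.range_nonempty _) (bddAbove_weighted f)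
  choose u hu using hvm
  obtain rfl : (fun n => (1 - ‖(u n : X)‖ ^ 2) * ‖f (u n)‖) = v := funext hu
  change Tendsto _ _ (𝓝 (weightedNorm f)) at hv
  have hcau : CauchySeq fun n => (u n : X) := by
    rw [Metric.cauchySeq_iff']
    intro ε hε
    obtain ⟨n, hn⟩ := exists_nat_one_div_lt (half_pos hε)
    obtain ⟨z, c, hc, h⟩ := hf n
    obtain ⟨N, hN⟩ := eventually_atTop.1 (hv.eventually (lt_mem_nhds hc))
    refine ⟨N, fun k hk => ?_⟩
    have h1 := h _ (hN k hk)
    have h2 := h _ (hN N le_rfl)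
    rw [← dist_eq_norm] at h1 h2
    linarith [dist_triangle_right (u k : X) (u N) z]
  obtain ⟨z, hz⟩ := cauchySeq_tendsto_of_complete hcau
  have hz1 : ‖z‖ ≤ 1 :=
    le_of_tendsto' hz.norm fun n => (mem_ball_zero_iff.1 (u n).2).le
  refine ⟨z, mem_closedBall_zero_iff.2 hz1, ?_⟩
  have hw : Tendsto (fun n => 1 - ‖(u n : X)‖ ^ 2) atTop (𝓝 (1 - ‖z‖ ^ 2)) :=
    tendsto_const_nhds.sub (hz.norm.pow 2)
  rcases hz1.lt_or_eq with hlt | heq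
  · have hzb : z ∈ ball (0 : X) 1 := mem_ball_zero_iff.2 hlt
    have hz' : Tendsto u atTop (𝓝 (⟨z, hzb⟩ : OpenUnitBall X)) := tendsto_subtype_rng.2 hz
    have h1 := hw.mul ((f.continuous.tendsto _).comp hz').norm
    have h2 := extendByZero_coe f ⟨z, hzb⟩
    simp only at h2
    rw [h2]
    exact tendsto_nhds_unique hv h1
  -- On the sphere the weight tends to `0` while `f` is bounded, so the weighted norm is `0`.
  · rw [heq] at hw ⊢
    have h1 : Tendsto (fun n => (1 - ‖(u n : X)‖ ^ 2) * ‖f‖) atTop (𝓝 ((1 - 1 ^ 2) * ‖f‖)) :=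
      hw.mul_const _
    have h2 : weightedNorm f ≤ (1 - 1 ^ 2) * ‖f‖ := le_of_tendsto_of_tendsto' hv h1 fun n =>
      mul_le_mul_of_nonneg_left (f.norm_coe_le_norm _) (weight_nonneg _)
    have h3 : 0 ≤ weightedNorm f :=
      Real.iSup_nonneg fun x => mul_nonneg (weight_nonneg x) (norm_nonneg _)
    norm_num at h2 ⊢
    exact le_antisymm h2 h3

end Weighted
-- Uniform convexity and peak functions
/-- Uniform convexity, with a modulus that is uniform in the radius `r ∈ [0, 1]`. -/
theorem exists_forall_norm_sub_lt_of_le_norm_add (E : Type*) [NormedAddCommGroup E]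
    [NormedSpace ℝ E] [UniformConvexSpace E] {ε : ℝ} (hε : 0 < ε) :
    ∃ δ, 0 < δ ∧ ∀ r : ℝ, 0 ≤ r → r ≤ 1 → ∀ x y : E, ‖x‖ ≤ r + δ → ‖y‖ ≤ r + δ →
      2 * r - δ ≤ ‖x + y‖ → ‖x - y‖ < ε := by
  obtain ⟨δ₁, hδ₁, h⟩ := exists_forall_closed_ball_dist_add_le_two_sub E (half_pos hε)
  refine ⟨min 1 (δ₁ * ε / 16), by positivity, fun r hr hr1 x y hx hy hxy => ?_⟩
  set δ := min 1 (δ₁ * ε / 16) with hδdef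
  have hδ : 0 < δ := by positivity
  have hδ1 : δ ≤ 1 := min_le_left _ _
  have hδ2 : δ ≤ δ₁ * ε / 16 := min_le_right _ _
  have hs : 0 < r + δ := by linarith
  by_contra! hcon
  -- After scaling by `(r + δ)⁻¹` the points are still `ε / 2` apart, so `2r - δ ≤ (2 - δ₁)(r + δ)`.
  -- With `r + δ ≥ ε / 2` this gives `δ₁ε / 2 ≤ 3δ`, against the choice of `δ`.
  have hs2 : ε / 2 ≤ r + δ := by linarith [norm_sub_le x y]
  have hscale : ∀ z : E, ‖(r + δ)⁻¹ • z‖ = ‖z‖ / (r + δ) := fun z => by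
    rw [norm_smul_of_nonneg (inv_nonneg.2 hs.le), div_eq_inv_mul]
  have key := h (x := (r + δ)⁻¹ • x) (by rw [hscale, div_le_one hs]; exact hx)
    (y := (r + δ)⁻¹ • y) (by rw [hscale, div_le_one hs]; exact hy)
    (by rw [← smul_sub, hscale, le_div_iff₀ hs]; nlinarith)
  rw [← smul_add, hscale, div_le_iff₀ hs] at key
  nlinarith [mul_le_mul_of_nonneg_left hs2 hδ₁.le, mul_pos hδ₁ hε]

section Peak

variable {X Y : Type*} [NormedAddCommGroup X] [NormedSpace ℂ X]
    [NormedAddCommGroup Y] [NormedSpace ℂ Y]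

theorem norm_apply_le_of_norm_le_one {φ : StrongDual ℂ X} (hφ : ‖φ‖ ≤ 1) (x : X) :
    ‖φ x‖ ≤ ‖x‖ := by
  simpa using φ.le_of_opNorm_le hφ x

theorem one_sub_le_norm_one_sub_mul {r : ℝ} (hr : 0 ≤ r) {w : ℂ} (hw : ‖w‖ ≤ 1) :
    1 - r ≤ ‖1 - (r : ℂ) * w‖ := by
  have h1 := norm_sub_norm_le (1 : ℂ) ((r : ℂ) * w)
  rw [norm_one, norm_mul, Complex.norm_real, Real.norm_of_nonneg hr] at h1
  nlinarith

/-- The Schwarz–Pick identity for the disc automorphism that exchanges `0` and `r`. -/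
theorem norm_sq_one_sub_mul (r : ℝ) (w : ℂ) :
    ‖1 - (r : ℂ) * w‖ ^ 2 = (1 - ‖w‖ ^ 2) * (1 - r ^ 2) + ‖w - r‖ ^ 2 := by
  simp only [Complex.sq_norm, Complex.normSq_apply, Complex.sub_re, Complex.sub_im,
    Complex.mul_re, Complex.mul_im, Complex.ofReal_re, Complex.ofReal_im, Complex.one_re,
    Complex.one_im]
  ring

/-- Drop the square `‖φ x - r‖ ^ 2` in the Schwarz–Pick identity and use `‖φ x‖ ≤ ‖x‖`. -/
theorem weighted_peak_le {φ : StrongDual ℂ X} (hφ : ‖φ‖ ≤ 1) {r : ℝ} (hr : 0 ≤ r) (hr1 : r < 1)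
    (x : OpenUnitBall X) :
    (1 - ‖(x : X)‖ ^ 2) * ‖((1 - (r : ℂ) * φ x)⁻¹) ^ 2‖ ≤ (1 - r ^ 2)⁻¹ := by
  have hx := mem_ball_zero_iff.1 x.2
  have hw := norm_apply_le_of_norm_le_one hφ (x : X)
  have hpos : 0 < ‖1 - (r : ℂ) * φ x‖ :=
    (sub_pos.2 hr1).trans_le (one_sub_le_norm_one_sub_mul hr (hw.trans hx.le))
  have hr2 : 0 < 1 - r ^ 2 := by nlinarith
  rw [norm_pow, norm_inv, inv_pow, ← div_eq_mul_inv, div_le_iff₀ (by positivity),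
    ← div_eq_inv_mul, le_div_iff₀ hr2, norm_sq_one_sub_mul]
  have : ‖φ x‖ ^ 2 ≤ ‖(x : X)‖ ^ 2 := by gcongr
  nlinarith [sq_nonneg ‖φ x - r‖]

/-- In a uniformly convex space the weighted peak functions peak at `x₀`, uniformly for
`‖x₀‖ ≤ R`. -/
theorem exists_forall_norm_sub_lt_of_lt_weighted_peak [UniformConvexSpace X] {ε R : ℝ}
    (hε : 0 < ε) (hR1 : R < 1) :
    ∃ η, 0 < η ∧ ∀ x₀ : X, ‖x₀‖ ≤ R → ∀ φ : StrongDual ℂ X, ‖φ‖ ≤ 1 → φ x₀ = ‖x₀‖ →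
      ∀ x : OpenUnitBall X,
        (1 - ‖x₀‖ ^ 2)⁻¹ - η < (1 - ‖(x : X)‖ ^ 2) * ‖((1 - (‖x₀‖ : ℂ) * φ x)⁻¹) ^ 2‖ →
        ‖(x : X) - x₀‖ < ε := by
  let : NormedSpace ℝ X := NormedSpace.complexToReal
  obtain ⟨δ, hδ, h⟩ := exists_forall_norm_sub_lt_of_le_norm_add X hε
  rcases lt_or_ge R 0 with hR0 | hR0
  · exact ⟨1, one_pos, fun x₀ hx₀ => absurd (hx₀.trans_lt hR0) (norm_nonneg _).not_gt⟩
  have hR2 : 0 < 1 - R ^ 2 := by nlinarith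
  -- Chosen so that a total defect of `4η` bounds `‖φ x - r‖` by `δ / 2` and `‖x‖² - ‖φ x‖²` by `δ²
  -- / 4`.
  refine ⟨δ ^ 2 * (1 - R ^ 2) / 16, by positivity, fun x₀ hx₀ φ hφ hφx₀ x hlt => ?_⟩
  have hx := mem_ball_zero_iff.1 x.2
  have hw := norm_apply_le_of_norm_le_one hφ (x : X)
  generalize hr : ‖x₀‖ = r at *
  have hr0 : 0 ≤ r := hr ▸ norm_nonneg _
  have hr1 : r < 1 := hx₀.trans_lt hR1
  have hpos : 0 < ‖1 - (r : ℂ) * φ x‖ :=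
    (sub_pos.2 hr1).trans_le (one_sub_le_norm_one_sub_mul hr0 (hw.trans hx.le))
  have hrR : r ^ 2 ≤ R ^ 2 := by gcongr
  have hr2 : 0 < 1 - r ^ 2 := by linarith
  have hle2 : ‖1 - (r : ℂ) * φ x‖ ≤ 2 := by
    refine (norm_sub_le _ _).trans ?_
    rw [norm_one, norm_mul, Complex.norm_real, Real.norm_of_nonneg hr0]
    nlinarith [norm_nonneg (φ (x : X))]
  have hle4 : ‖1 - (r : ℂ) * φ x‖ ^ 2 ≤ 4 := by nlinarith
  have hid := norm_sq_one_sub_mul r (φ x)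
  set η := δ ^ 2 * (1 - R ^ 2) / 16 with hη
  have hη0 : 0 < η := by positivity
  set A := ‖1 - (r : ℂ) * φ x‖ ^ 2 with hA
  have hA0 : 0 < A := by positivity
  rw [norm_pow, norm_inv, inv_pow, ← div_eq_mul_inv, lt_div_iff₀ hA0] at hlt
  -- Clear denominators in `hlt` and subtract the Schwarz–Pick identity; both defects are
  -- nonnegative.
  have hdef : ‖φ x - r‖ ^ 2 + (‖(x : X)‖ ^ 2 - ‖φ x‖ ^ 2) * (1 - r ^ 2) ≤ 4 * η := by
    have h1 := mul_lt_mul_of_pos_right hlt hr2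
    have h2 : ((1 - r ^ 2)⁻¹ - η) * A * (1 - r ^ 2) = A - η * A * (1 - r ^ 2) := by
      field_simp
    rw [h2] at h1
    have h3 : η * A * (1 - r ^ 2) ≤ 4 * η := by
      have h4 : A * (1 - r ^ 2) ≤ 4 := by nlinarith [sq_nonneg r]
      nlinarith
    linarith
  have hsq : ‖φ x‖ ^ 2 ≤ ‖(x : X)‖ ^ 2 := by gcongr
  have hηδ : 4 * η ≤ (δ / 2) ^ 2 := by
    rw [hη]; nlinarith [mul_nonneg (sq_nonneg δ) (sq_nonneg R)]
  have hwr : ‖φ x - r‖ ≤ δ / 2 := by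
    refine abs_le_of_sq_le_sq' ?_ (by positivity) |>.2
    nlinarith [mul_nonneg (sub_nonneg.2 hsq) hr2.le]
  have hwn : ‖φ x‖ ≤ r + δ / 2 := by
    have h1 := norm_sub_norm_le (φ x) (r : ℂ)
    rw [Complex.norm_real, Real.norm_of_nonneg hr0] at h1
    linarith
  have hxn : ‖(x : X)‖ ≤ r + δ := by
    refine abs_le_of_sq_le_sq' ?_ (by positivity) |>.2
    have h1 : (‖(x : X)‖ ^ 2 - ‖φ x‖ ^ 2) * (1 - R ^ 2) ≤ δ ^ 2 / 4 * (1 - R ^ 2) := by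
      have h2 : (‖(x : X)‖ ^ 2 - ‖φ x‖ ^ 2) * (1 - R ^ 2) ≤
          (‖(x : X)‖ ^ 2 - ‖φ x‖ ^ 2) * (1 - r ^ 2) :=
        mul_le_mul_of_nonneg_left (by linarith) (sub_nonneg.2 hsq)
      nlinarith [sq_nonneg ‖φ x - r‖]
    have h3 := le_of_mul_le_mul_right h1 hR2
    have h4 : ‖φ x‖ ^ 2 ≤ (r + δ / 2) ^ 2 := by gcongr
    nlinarith [mul_nonneg hr0 hδ.le]
  refine h r hr0 hr1.le x x₀ hxn (by linarith) ?_
  have h1 := norm_apply_le_of_norm_le_one hφ ((x : X) + x₀)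
  rw [map_add, hφx₀] at h1
  have h2 := norm_sub_norm_le ((r : ℂ) + r) (r - φ x)
  rw [show (r : ℂ) + r - (r - φ x) = φ x + r by ring, norm_sub_rev (r : ℂ), ← Complex.ofReal_add,
    Complex.norm_real, Real.norm_of_nonneg (by positivity)] at h2
  linarith

/-- The function `x ↦ (1 - r φ(x))⁻² y` belongs to `𝒜_u(B_X; Y)`. -/
theorem exists_mem_Au_peak {φ : StrongDual ℂ X} (hφ : ‖φ‖ ≤ 1) {r : ℝ} (hr : 0 ≤ r) (hr1 : r < 1)
    (y : Y) :
    ∃ h : OpenUnitBall X →ᵇ Y, h ∈ Au X Y ∧ ‖h‖ ≤ ((1 - r)⁻¹) ^ 2 * ‖y‖ ∧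
      ∀ x, h x = ((1 - (r : ℂ) * φ x)⁻¹) ^ 2 • y := by
  have hw : ∀ x : OpenUnitBall X, ‖φ x‖ ≤ 1 := fun x =>
    (norm_apply_le_of_norm_le_one hφ (x : X)).trans (mem_ball_zero_iff.1 x.2).le
  have hne : ∀ w : ℂ, ‖w‖ ≤ 1 → 1 - (r : ℂ) * w ≠ 0 := fun w hw' =>
    norm_pos_iff.1 ((sub_pos.2 hr1).trans_le (one_sub_le_norm_one_sub_mul hr hw'))
  have hbound : ∀ x : OpenUnitBall X,
      ‖((1 - (r : ℂ) * φ x)⁻¹) ^ 2 • y‖ ≤ ((1 - r)⁻¹) ^ 2 * ‖y‖ := fun x => by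
    rw [norm_smul, norm_pow, norm_inv]
    have := one_sub_le_norm_one_sub_mul hr (hw x)
    have := sub_pos.2 hr1
    gcongr
  have huc : UniformContinuous fun x : OpenUnitBall X => ((1 - (r : ℂ) * φ x)⁻¹) ^ 2 • y := by
    have h1 : UniformContinuousOn (fun w : ℂ => ((1 - (r : ℂ) * w)⁻¹) ^ 2 • y)
        (closedBall 0 1) := by
      refine (isCompact_closedBall (0 : ℂ) 1).uniformContinuousOn_of_continuous ?_
      refine ContinuousOn.smul (ContinuousOn.pow (ContinuousOn.inv₀ (by fun_prop) ?_) 2)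
        continuousOn_const
      exact fun w hw' => hne w (mem_closedBall_zero_iff.1 hw')
    have h2 : UniformContinuous fun x : OpenUnitBall X =>
        (⟨φ x, mem_closedBall_zero_iff.2 (hw x)⟩ : closedBall (0 : ℂ) 1) :=
      (φ.uniformContinuous.comp uniformContinuous_subtype_val).subtype_mk _
    have h3 := (uniformContinuousOn_iff_restrict.1 h1).comp h2
    exact h3
  set h := BoundedContinuousFunction.ofNormedAddCommGroup _ huc.continuous _ hbound
  have hval : ∀ x, h x = ((1 - (r : ℂ) * φ x)⁻¹) ^ 2 • y := fun _ => rfl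
  refine ⟨h, ⟨?_, huc⟩, (BoundedContinuousFunction.norm_le (by positivity)).2 fun x => ?_, hval⟩
  swap
  · rw [hval]
    exact hbound x
  have hd : DifferentiableOn ℂ (fun x : X => ((1 - (r : ℂ) * φ x)⁻¹) ^ 2 • y) (ball 0 1) := by
    refine DifferentiableOn.smul_const (DifferentiableOn.pow (DifferentiableOn.inv ?_ ?_) 2) y
    · fun_prop
    · exact fun x hx => hne _ (hw ⟨x, hx⟩)
  exact hd.congr fun x hx => (extendByZero_coe h ⟨x, hx⟩).trans (hval _)

/-! ### Density of peaking functions -/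

omit [NormedSpace ℂ X] [NormedSpace ℂ Y] in
theorem weightedNorm_pos {f : OpenUnitBall X →ᵇ Y} (hf : f ≠ 0) : 0 < weightedNorm f := by
  obtain ⟨x, hx⟩ : ∃ x, f x ≠ 0 := by
    by_contra! h
    exact hf (BoundedContinuousFunction.ext h)
  exact (mul_pos (weight_pos x) (norm_pos_iff.2 hx)).trans_le (weighted_le_weightedNorm f x)

omit [NormedSpace ℂ X] [NormedSpace ℂ Y] in
/-- Near-maximizers of the weighted values of a nonzero `f` stay away from the unit sphere. -/
theorem exists_radius_of_lt_weighted {f : OpenUnitBall X →ᵇ Y} (hf : f ≠ 0) :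
    ∃ R, R < 1 ∧ ∀ x : OpenUnitBall X,
      weightedNorm f / 2 < (1 - ‖(x : X)‖ ^ 2) * ‖f x‖ → ‖(x : X)‖ ≤ R := by
  have hM := weightedNorm_pos hf
  have hf0 : 0 < ‖f‖ := norm_pos_iff.2 hf
  have hq : 0 < weightedNorm f / 2 / ‖f‖ := by positivity
  refine ⟨√(1 - weightedNorm f / 2 / ‖f‖), ?_, fun x hx => Real.le_sqrt_of_sq_le ?_⟩
  · rw [Real.sqrt_lt' one_pos]
    linarith
  · have h1 := hx.trans_le (mul_le_mul_of_nonneg_left (f.norm_coe_le_norm x) (weight_nonneg x))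
    rw [← div_lt_iff₀ hf0] at h1
    linarith

/-- Every nonzero element of `𝒜_u(B_X; Y)` is approximated by elements whose weighted values peak
within a ball of a prescribed radius. -/
theorem exists_peaksWithin_dist_lt [UniformConvexSpace X] (f : Au X Y) (hf : f ≠ 0) {ε δ : ℝ}
    (hε : 0 < ε) (hδ : 0 < δ) :
    ∃ g : Au X Y, dist g f < δ ∧ PeaksWithin ε (g.1 : OpenUnitBall X → Y) := by
  obtain ⟨f, hfA⟩ := f
  have hf' : f ≠ 0 := fun h => hf (Subtype.ext h)
  have hM := weightedNorm_pos hf'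
  obtain ⟨R, hR1, hR⟩ := exists_radius_of_lt_weighted hf'
  obtain ⟨η, hη, hpeak⟩ := exists_forall_norm_sub_lt_of_lt_weighted_peak (X := X) hε hR1
  have hR' : 0 < 1 - R := sub_pos.2 hR1
  -- Since `‖h‖ ≤ (1 - R)⁻²`, the perturbation has norm at most `δ / 2`.
  set t := δ * (1 - R) ^ 2 / 2 with ht
  have ht0 : 0 < t := by positivity
  -- The first bound keeps `‖x₀‖ ≤ R` and `f x₀ ≠ 0`; the second loses only `t * η / 2`, less than
  -- the drop `t * η` in the peak threshold.
  obtain ⟨x₀, hx₀⟩ := exists_lt_weighted f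
    (c := max (weightedNorm f / 2) (weightedNorm f - t * η / 2))
    (max_lt (by linarith) (by nlinarith))
  have hx₀1 := (le_max_left _ _).trans_lt hx₀
  have hx₀2 := (le_max_right _ _).trans_lt hx₀
  have hx₀R := hR x₀ hx₀1
  have hfx₀ : f x₀ ≠ 0 := by
    intro h0
    rw [h0, norm_zero, mul_zero] at hx₀1
    linarith
  obtain ⟨φ, hφ, (hφx₀ : φ x₀ = ((‖(x₀ : X)‖ : ℝ) : ℂ))⟩ := exists_dual_vector'' ℂ (x₀ : X)
  have hr0 := norm_nonneg (x₀ : X)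
  have hr1 : ‖(x₀ : X)‖ < 1 := mem_ball_zero_iff.1 x₀.2
  have hw₀ := weight_pos x₀
  set y : Y := ((‖f x₀‖⁻¹ : ℝ) : ℂ) • f x₀ with hy
  have hfn : 0 < ‖f x₀‖ := norm_pos_iff.2 hfx₀
  have hy1 : ‖y‖ = 1 := by
    rw [hy, norm_smul, Complex.norm_real, norm_inv, norm_norm, inv_mul_cancel₀ hfn.ne']
  obtain ⟨h, hA, hnorm, hval⟩ := exists_mem_Au_peak hφ hr0 hr1 y
  have hwh : ∀ x : OpenUnitBall X, (1 - ‖(x : X)‖ ^ 2) * ‖h x‖ =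
      (1 - ‖(x : X)‖ ^ 2) * ‖((1 - (‖(x₀ : X)‖ : ℂ) * φ x)⁻¹) ^ 2‖ := fun x => by
    rw [hval, norm_smul, hy1, mul_one]
  -- `h x₀` is a positive multiple of `f x₀`, so the norms add.
  have hwh₀ : (1 - ‖(x₀ : X)‖ ^ 2) * ‖f x₀ + (t : ℂ) • h x₀‖ =
      (1 - ‖(x₀ : X)‖ ^ 2) * ‖f x₀‖ + t * (1 - ‖(x₀ : X)‖ ^ 2)⁻¹ := by
    have h1 : f x₀ + (t : ℂ) • h x₀ =
        ((1 + t * ((1 - ‖(x₀ : X)‖ ^ 2)⁻¹) ^ 2 * ‖f x₀‖⁻¹ : ℝ) : ℂ) • f x₀ := by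
      rw [hval, hφx₀, hy, smul_smul, smul_smul]
      nth_rewrite 1 [← one_smul ℂ (f x₀)]
      rw [← add_smul]
      congr 1
      push_cast
      ring
    rw [h1, norm_smul, Complex.norm_real, Real.norm_of_nonneg (by positivity)]
    field_simp
  refine ⟨⟨f + (t : ℂ) • h, (Au X Y).add_mem hfA ((Au X Y).smul_mem _ hA)⟩, ?_, x₀,
    weightedNorm f + t * (1 - ‖(x₀ : X)‖ ^ 2)⁻¹ - t * η, ?_, fun x hx => ?_⟩
  · rw [Subtype.dist_eq, dist_eq_norm, add_sub_cancel_left, norm_smul, Complex.norm_real,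
      Real.norm_of_nonneg ht0.le]
    have h1 : ‖h‖ ≤ ((1 - R)⁻¹) ^ 2 := by
      rw [hy1, mul_one] at hnorm
      refine hnorm.trans ?_
      gcongr
    calc t * ‖h‖ ≤ t * ((1 - R)⁻¹) ^ 2 := by gcongr
      _ = δ / 2 := by rw [ht]; field_simp
      _ < δ := half_lt_self hδ
  · have h1 := weighted_le_weightedNorm (f + (t : ℂ) • h) x₀
    rw [BoundedContinuousFunction.add_apply, BoundedContinuousFunction.smul_apply, hwh₀] at h1
    have := mul_pos ht0 hη
    simp only
    linarith
  · refine hpeak x₀ hx₀R φ hφ hφx₀ x ?_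
    simp only [BoundedContinuousFunction.add_apply, BoundedContinuousFunction.smul_apply] at hx
    have h1 := mul_le_mul_of_nonneg_left (norm_add_le (f x) ((t : ℂ) • h x)) (weight_nonneg x)
    rw [norm_smul, Complex.norm_real, Real.norm_of_nonneg ht0.le, mul_add, mul_left_comm,
      hwh] at h1
    have h2 := weighted_le_weightedNorm f x
    refine lt_of_mul_lt_mul_left (a := t) ?_ ht0.le
    linarith

end Peak

theorem corollary3p4 {X Y : Type*}
    [NormedAddCommGroup X] [NormedSpace ℂ X] [CompleteSpace X] [UniformConvexSpace X]
    [NormedAddCommGroup Y] [NormedSpace ℂ Y] [CompleteSpace Y] :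
    closure (NAvAu X Y) = (Set.univ : Set (Au X Y)) := by
  have hzero : (0 : Au X Y) ∈ NAvAu X Y :=
    ⟨0, mem_closedBall_self zero_le_one, by
      have h1 := extendByZero_coe (⇑(0 : OpenUnitBall X →ᵇ Y)) ⟨0, mem_ball_self one_pos⟩
      change extendByZero (⇑(0 : OpenUnitBall X →ᵇ Y)) 0 = 0 at h1
      change weightedNorm (⇑(0 : OpenUnitBall X →ᵇ Y)) = _ * ‖extendByZero (⇑(0 : OpenUnitBall X →ᵇ Y)) 0‖
      rw [h1]
      simp [weightedNorm]⟩
  -- Density is known only near nonzero `f`; this suffices once `{0}ᶜ` is dense, which needs a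
  -- nontrivial space.
  rcases subsingleton_or_nontrivial (Au X Y) with hsub | hnt
  · exact Set.eq_univ_of_forall fun f => subset_closure (Subsingleton.elim 0 f ▸ hzero)
  have : CompleteSpace (Au X Y) := (isClosed_Au X Y).completeSpace_coe
  have : NeBot (𝓝[≠] (0 : Au X Y)) := Module.punctured_nhds_neBot ℂ (Au X Y) 0
  rw [← dense_iff_closure_eq]
  set U : ℕ → Set (Au X Y) := fun n =>
    {f | PeaksWithin (1 / ((n : ℝ) + 1)) (f.1 : OpenUnitBall X → Y)}
  have hopen : ∀ n, IsOpen (U n) := fun n =>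
    (isOpen_peaksWithin (1 / ((n : ℝ) + 1))).preimage continuous_subtype_val
  have hdense : ∀ n, Dense (U n) := fun n =>
    ((dense_compl_singleton (0 : Au X Y)).mono fun f hf => Metric.mem_closure_iff.2 fun δ hδ => by
      obtain ⟨g, hg, hgU⟩ := exists_peaksWithin_dist_lt f hf (ε := 1 / ((n : ℝ) + 1))
        (by positivity) hδ
      exact ⟨g, hgU, dist_comm f g ▸ hg⟩).of_closure
  exact (dense_iInter_of_isOpen_nat hopen hdense).mono fun f hf =>
    attainsWeightedNorm_of_peaksWithin f.1 fun n => Set.mem_iInter.1 hf n
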